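/- Let $k\ge \ell\ge 1$ be integers, let $\varepsilon>0$ be real, and let $V$ be a finite set with $n:=|V|\ge 2k$. For $f\colon\binom{V}{k}\to\mathbb{R}$ and $1\le r\le k$ put $$W^r(f)=\left(\mathbb{E}_{(a_1,b_1,\ldots,a_r,b_r)}\Big(\mathbb{E}_{R}\,(-1)^{|R\cap\{b_1,\ldots,b_r\}|}f(R)\Big)^2\right)^{1/2},$$ where $(a_1,b_1,\ldots,a_r,b_r)$ is a uniformly random sequence of $2r$ distinct elements of $V$, and $R$ is a uniformly random $k$-subset of $V$ satisfying $|R\cap\{a_i,b_i\}|=1$ for each $1\le i\le r$. If $f\colon\binom{V}{k}\to\mathbb{R}$ satisfies $\max_{\ell\le r\le k}W^r(f)\le\varepsilon$, then there exists $\tilde f\colon\binom{V}{k}\to\mathbb{R}$ such that (i) for all but at most $5^{k/2}\varepsilon^{1/2}\binom{n}{k}$ sets $R\in\binom{V}{k}$, we have $|f(R)-\tilde f(R)|\le\varepsilon^{1/2}$; and (ii) $W^k(\tilde f)=\cdots=W^{\ell}(\tilde f)=0$. -/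

import Mathlib

open Finset
open scoped BigOperators

/-- The `k`-element subsets of `V`. -/
abbrev KSubset (V : Type*) (k : ℕ) : Type _ := {R : Finset V // R.card = k}

/-- A `2r`-permutation `(a₁, b₁, …, a_r, b_r)` of `V`: a sequence of `2r` distinct elements, where
`a i` is the value at `Sum.inl i` and `b i` is the value at `Sum.inr i`. -/
abbrev PairPerm (V : Type*) (r : ℕ) : Type _ := (Fin r ⊕ Fin r) ↪ V

/-- The `k`-subsets `R` of `V` with `|R ∩ {a_i, b_i}| = 1` for every `i`. -/
def transversals {V : Type*} [Fintype V] [DecidableEq V] (k : ℕ) {r : ℕ}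
    (p : PairPerm V r) : Finset (KSubset V k) :=
  univ.filter fun R => ∀ i : Fin r, (R.1 ∩ {p (Sum.inl i), p (Sum.inr i)}).card = 1

/-- The signed average `𝔼_R (-1)^{|R ∩ {b₁, …, b_r}|} f(R)` over the `k`-subsets `R` that meet each
pair `{a_i, b_i}` in exactly one point. -/
noncomputable def signedAverage {V : Type*} [Fintype V] [DecidableEq V] {k r : ℕ}
    (f : KSubset V k → ℝ) (p : PairPerm V r) : ℝ :=
  𝔼 R ∈ transversals k p,
    (-1 : ℝ) ^ (R.1 ∩ univ.image fun i : Fin r => p (Sum.inr i)).card * f R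

/-- The level-`r` weight `W^r(f)` of a weighted `k`-uniform hypergraph `f`. -/
noncomputable def levelWeight {V : Type*} [Fintype V] [DecidableEq V] {k : ℕ}
    (r : ℕ) (f : KSubset V k → ℝ) : ℝ :=
  Real.sqrt (𝔼 p : PairPerm V r, signedAverage f p ^ 2)

/-! The function `pairSign p` is supported on the transversals of `p` and carries there the sign in
the signed average. So that average is `⟨f, pairSign p⟩ / ⟨pairSign p, pairSign p⟩`, and `W^r(f)`
measures the projection `g_r` of `f` onto the span of the level-`r` sign functions. Spans of
different levels are orthogonal, so `f - ∑ g_r` over `ℓ ≤ r ≤ k` has zero weight at all these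
levels.

To bound `g_r`, note that a function on `r`-sets antisymmetric under all the swaps `(a_i b_i)` is
determined by its value at `{a_1, …, a_r}`. Permutation-invariant kernels therefore act on the sign
functions as scalars, which replaces Schur's lemma. Hence `∑ p, ⟨f, pairSign p⟩ pairSign p` is a
multiple of `g_r`, and estimates of the scalars give `‖g_r‖² ≤ 2^r C(k,r) C(n,k) W^r(f)²`. Summing
over `r` bounds the total correction in `L²`; Cauchy–Schwarz and Markov finish. -/

section
variable {V : Type*} [Fintype V] [DecidableEq V] {k m r s : ℕ}

/-! ### Sign functions and antisymmetry -/

/-- The action of a permutation of `V` on the `k`-subsets of `V`. -/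
def KSubset.perm (k : ℕ) (σ : Equiv.Perm V) : Equiv.Perm (KSubset V k) :=
  (Equiv.finsetCongr σ).subtypeEquiv fun R => by simp

omit [Fintype V] [DecidableEq V] in
theorem KSubset.mem_perm (σ : Equiv.Perm V) (R : KSubset V k) (x : V) :
    x ∈ (KSubset.perm k σ R).1 ↔ σ.symm x ∈ R.1 := by
  simp [KSubset.perm, Finset.mem_map_equiv]

/-- The product `∏ i, (1_{a_i ∈ R} - 1_{b_i ∈ R})`. -/
def pairSign (p : PairPerm V r) (R : KSubset V k) : ℝ :=
  ∏ i, ((if p (Sum.inl i) ∈ R.1 then 1 else 0) - (if p (Sum.inr i) ∈ R.1 then 1 else 0))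

omit [Fintype V] in
theorem pairSign_perm (σ : Equiv.Perm V) (p : PairPerm V r) (R : KSubset V k) :
    pairSign (p.trans σ.toEmbedding) (KSubset.perm k σ R) = pairSign p R := by
  simp [pairSign, KSubset.mem_perm]

/-- A function on `k`-subsets that changes sign under each transposition `(a_i b_i)`. -/
def IsPairAntisymm (p : PairPerm V r) (h : KSubset V k → ℝ) : Prop :=
  ∀ i R, h (KSubset.perm k (Equiv.swap (p (Sum.inl i)) (p (Sum.inr i))) R) = -h R

omit [Fintype V] in
theorem isPairAntisymm_pairSign (p : PairPerm V r) :
    IsPairAntisymm (k := k) p (pairSign p) := by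
  intro i R
  have hne : ∀ {x y : Fin r ⊕ Fin r}, x ≠ y → p x ≠ p y := fun h => p.injective.ne h
  unfold pairSign
  rw [← Finset.mul_prod_erase univ _ (mem_univ i), ← Finset.mul_prod_erase univ _ (mem_univ i),
    ← neg_mul]
  congr 1
  · simp [KSubset.mem_perm]
  · refine Finset.prod_congr rfl fun j hj => ?_
    have hj : j ≠ i := (Finset.mem_erase.mp hj).1
    simp only [KSubset.mem_perm, Equiv.symm_swap]
    rw [Equiv.swap_apply_of_ne_of_ne (hne (by simp [hj])) (hne (by simp)),
      Equiv.swap_apply_of_ne_of_ne (hne (by simp)) (hne (by simp [hj]))]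

omit [Fintype V] in
-- If `R` contains both or neither of some `a_i`, `b_i`, the swap fixes `R`, so `h R = -h R`.
-- Otherwise swapping a `b_i` out of `R` only changes the sign and lowers the number of `b_i` in
-- `R`, which drives the induction.
theorem IsPairAntisymm.eq_zero {p : PairPerm V r} {h : KSubset V k → ℝ} (hh : IsPairAntisymm p h)
    (h0 : ∀ R : KSubset V k, (∀ i, p (Sum.inl i) ∈ R.1) → (∀ i, p (Sum.inr i) ∉ R.1) → h R = 0)
    (R : KSubset V k) : h R = 0 := by
  have hne : ∀ {x y : Fin r ⊕ Fin r}, x ≠ y → p x ≠ p y := fun h => p.injective.ne h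
  induction hn : (univ.filter fun i => p (Sum.inr i) ∈ R.1).card using Nat.strong_induction_on
    generalizing R with
  | _ n ih =>
  by_cases hT : ∃ i, (p (Sum.inl i) ∈ R.1 ↔ p (Sum.inr i) ∈ R.1)
  · obtain ⟨i, hi⟩ := hT
    have hR : KSubset.perm k (Equiv.swap (p (Sum.inl i)) (p (Sum.inr i))) R = R := by
      apply Subtype.ext
      ext x
      rw [KSubset.mem_perm, Equiv.symm_swap]
      rcases eq_or_ne x (p (Sum.inl i)) with rfl | h1
      · simp [hi]
      rcases eq_or_ne x (p (Sum.inr i)) with rfl | h2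
      · simp [hi]
      rw [Equiv.swap_apply_of_ne_of_ne h1 h2]
    have := hh i R
    rw [hR] at this
    linarith
  push Not at hT
  by_cases hb : ∃ i, p (Sum.inr i) ∈ R.1
  · obtain ⟨i, hi⟩ := hb
    have hai : p (Sum.inl i) ∉ R.1 := by
      rcases hT i with h | h
      · exact absurd hi h.2
      · exact h.1
    have key := hh i R
    rw [ih _ _ _ rfl] at key
    · linarith
    · rw [← hn]
      apply Finset.card_lt_card
      rw [Finset.ssubset_iff_of_subset]
      · refine ⟨i, by simpa using hi, ?_⟩
        simp [KSubset.mem_perm, hai]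
      · intro j
        simp only [mem_filter, mem_univ, true_and, KSubset.mem_perm, Equiv.symm_swap]
        rcases eq_or_ne j i with rfl | hj
        · exact fun _ => hi
        · rw [Equiv.swap_apply_of_ne_of_ne (hne (by simp)) (hne (by simp [hj]))]
          exact id
  · push Not at hb
    refine h0 R (fun i => ?_) hb
    rcases hT i with h | h
    · exact h.1
    · exact absurd h.2 (hb i)

/-! ### Invariant kernels -/

/-- A kernel that is invariant under the permutations of `V`. -/
def IsInvariantKernel (L : KSubset V m → KSubset V k → ℝ) : Prop :=
  ∀ σ A R, L (KSubset.perm m σ A) (KSubset.perm k σ R) = L A R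

omit [DecidableEq V] in
theorem IsInvariantKernel.sum_perm {L : KSubset V m → KSubset V k → ℝ} (hL : IsInvariantKernel L)
    (σ : Equiv.Perm V) (h : KSubset V k → ℝ) (A : KSubset V m) :
    ∑ R, L (KSubset.perm m σ A) R * h R = ∑ R, L A R * h (KSubset.perm k σ R) := by
  rw [← Equiv.sum_comp (KSubset.perm k σ)]
  simp only [hL σ]

theorem IsInvariantKernel.isPairAntisymm {L : KSubset V m → KSubset V k → ℝ}
    (hL : IsInvariantKernel L) (q : PairPerm V r) :
    IsPairAntisymm q fun A => ∑ R, L A R * pairSign q R := by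
  intro i A
  simp only
  rw [hL.sum_perm, ← Finset.sum_neg_distrib]
  refine Finset.sum_congr rfl fun R _ => ?_
  rw [isPairAntisymm_pairSign q i R, mul_neg]

/-- The `r`-set `{a_1, …, a_r}`. -/
def pairLeft (q : PairPerm V r) : KSubset V r :=
  ⟨univ.image fun i => q (Sum.inl i), by
    rw [Finset.card_image_of_injective _ (fun i j h => Sum.inl_injective (q.injective h))]; simp⟩

omit [Fintype V] in
theorem eq_pairLeft {q : PairPerm V r} {A : KSubset V r} (h : ∀ i, q (Sum.inl i) ∈ A.1) :
    A = pairLeft q := by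
  apply Subtype.ext
  symm
  apply Finset.eq_of_subset_of_card_le
  · intro x hx
    obtain ⟨i, -, rfl⟩ := Finset.mem_image.mp hx
    exact h i
  · rw [A.2, (pairLeft q).2]

omit [Fintype V] in
theorem pairSign_pairLeft (q : PairPerm V r) : pairSign q (pairLeft q) = 1 := by
  simp [pairSign, pairLeft]

/-- The image is antisymmetric, and a set of size `m < r` cannot contain all the `a_i`. -/
theorem IsInvariantKernel.sum_mul_pairSign_eq_zero {L : KSubset V m → KSubset V k → ℝ}
    (hL : IsInvariantKernel L) (hm : m < r) (q : PairPerm V r) (A : KSubset V m) :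
    ∑ R, L A R * pairSign q R = 0 := by
  refine (hL.isPairAntisymm q).eq_zero (fun B hB _ => ?_) A
  exfalso
  have := Finset.card_le_card (s := (pairLeft q).1) (t := B.1) (by
    intro x hx
    obtain ⟨i, -, rfl⟩ := Finset.mem_image.mp hx
    exact hB i)
  rw [(pairLeft q).2, B.2] at this
  omega

omit [Fintype V] [DecidableEq V] in
theorem exists_perm_trans (p q : PairPerm V r) :
    ∃ σ : Equiv.Perm V, q = p.trans σ.toEmbedding := by
  obtain ⟨σ, hσ⟩ := Equiv.Perm.exists_extending_pair p q p.injective q.injective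
  exact ⟨σ, by ext x; simp [← hσ]⟩

/-- An invariant kernel acts on the functions `pairSign q` as a scalar. -/
theorem IsInvariantKernel.exists_sum_mul_pairSign {L : KSubset V r → KSubset V k → ℝ}
    (hL : IsInvariantKernel L) :
    ∃ d : ℝ, ∀ (q : PairPerm V r) A, ∑ R, L A R * pairSign q R = d * pairSign q A := by
  rcases isEmpty_or_nonempty (PairPerm V r) with he | ⟨⟨q₀⟩⟩
  · exact ⟨0, fun q => he.elim q⟩
  have h1 : ∀ (q : PairPerm V r) A,
      ∑ R, L A R * pairSign q R = (∑ R, L (pairLeft q) R * pairSign q R) * pairSign q A := by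
    intro q A
    rw [← sub_eq_zero]
    refine IsPairAntisymm.eq_zero (p := q)
      (h := fun A => ∑ R, L A R * pairSign q R - (∑ R, L (pairLeft q) R * pairSign q R) * pairSign q A)
      (fun i B => ?_) (fun B hB _ => ?_) A
    · have := hL.isPairAntisymm q i B
      simp only at this ⊢
      rw [this, isPairAntisymm_pairSign q i B]
      ring
    · rw [eq_pairLeft hB, pairSign_pairLeft]
      ring
  refine ⟨∑ R, L (pairLeft q₀) R * pairSign q₀ R, fun q A => ?_⟩
  rw [h1 q A]
  congr 1
  -- Permutations of `V` act transitively on the `2r`-permutations, so the scalar does not depend on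
  -- `q`.
  obtain ⟨σ, rfl⟩ := exists_perm_trans q₀ q
  have : pairLeft (q₀.trans σ.toEmbedding) = KSubset.perm r σ (pairLeft q₀) := by
    symm
    apply eq_pairLeft
    intro i
    simp [KSubset.mem_perm, pairLeft]
  rw [this, hL.sum_perm]
  simp only [pairSign_perm]

/-! ### Inclusion and orthogonality of levels -/

/-- The inclusion kernel. -/
def inclusion (A : KSubset V m) (R : KSubset V k) : ℝ := if A.1 ⊆ R.1 then 1 else 0

omit [Fintype V] in
theorem isInvariantKernel_inclusion :
    IsInvariantKernel (inclusion : KSubset V m → KSubset V k → ℝ) := by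
  intro σ A R
  simp [inclusion, KSubset.perm, Finset.map_subset_map]

/-- Both sides are antisymmetric. When `R` contains every `a_i` and no `b_i`, only `A = {a_1, …,
a_r}` contributes. -/
theorem pairSign_eq_sum_inclusion (p : PairPerm V r) (R : KSubset V k) :
    pairSign p R = ∑ A : KSubset V r, inclusion A R * pairSign p A := by
  have hL : IsInvariantKernel fun (R : KSubset V k) (A : KSubset V r) => inclusion A R :=
    fun σ R A => isInvariantKernel_inclusion σ A R
  rw [← sub_eq_zero]
  refine IsPairAntisymm.eq_zero (p := p)
    (h := fun R => pairSign p R - ∑ A : KSubset V r, inclusion A R * pairSign p A)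
    (fun i B => ?_) (fun B hB hB' => ?_) R
  · have := hL.isPairAntisymm p i B
    simp only at this ⊢
    rw [this, isPairAntisymm_pairSign p i B]
    ring
  · rw [Finset.sum_eq_single (pairLeft p)]
    · rw [pairSign_pairLeft]
      have : (pairLeft p).1 ⊆ B.1 := by
        intro x hx
        obtain ⟨i, -, rfl⟩ := Finset.mem_image.mp hx
        exact hB i
      simp [inclusion, this, pairSign, hB, hB']
    · intro A _ hA
      rw [inclusion]
      split_ifs with hAB
      · have : ∃ i, p (Sum.inl i) ∉ A.1 := by
          by_contra! hc
          exact hA (eq_pairLeft hc)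
        obtain ⟨i, hi⟩ := this
        rw [one_mul, pairSign, Finset.prod_eq_zero (mem_univ i)]
        have hi' : p (Sum.inr i) ∉ A.1 := fun h => hB' i (hAB h)
        simp [hi, hi']
      · simp
    · simp

/-- The lower-level function is a combination of inclusion indicators of `r`-sets, and each of these
is orthogonal to level `s > r`. -/
theorem pairSign_dotProduct_eq_zero_of_lt (h : r < s) (p : PairPerm V r) (q : PairPerm V s) :
    (pairSign p : KSubset V k → ℝ) ⬝ᵥ pairSign q = 0 := by
  simp only [dotProduct]
  rw [Finset.sum_congr rfl fun R _ => by rw [pairSign_eq_sum_inclusion p R, Finset.sum_mul]]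
  rw [Finset.sum_comm]
  refine Finset.sum_eq_zero fun A _ => ?_
  have := isInvariantKernel_inclusion.sum_mul_pairSign_eq_zero (k := k) h q A
  rw [← mul_zero (pairSign p A), ← this, Finset.mul_sum]
  exact Finset.sum_congr rfl fun R _ => by ring

theorem pairSign_dotProduct_eq_zero (h : r ≠ s) (p : PairPerm V r) (q : PairPerm V s) :
    (pairSign p : KSubset V k → ℝ) ⬝ᵥ pairSign q = 0 := by
  rcases h.lt_or_gt with h | h
  · exact pairSign_dotProduct_eq_zero_of_lt h p q
  · rw [dotProduct_comm]
    exact pairSign_dotProduct_eq_zero_of_lt h q p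

/-! ### Signed averages as inner products -/

omit [Fintype V] in
theorem card_inter_pair_eq_one_iff (p : PairPerm V r) (R : Finset V) (i : Fin r) :
    (R ∩ {p (Sum.inl i), p (Sum.inr i)}).card = 1 ↔
      ¬(p (Sum.inl i) ∈ R ↔ p (Sum.inr i) ∈ R) := by
  have hne : p (Sum.inl i) ≠ p (Sum.inr i) := p.injective.ne (by simp)
  by_cases ha : p (Sum.inl i) ∈ R <;> by_cases hb : p (Sum.inr i) ∈ R <;>
    simp [ha, hb, Finset.inter_insert_of_mem, Finset.inter_insert_of_notMem, hne]

theorem pairSign_of_mem_transversals {p : PairPerm V r} {R : KSubset V k}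
    (h : R ∈ transversals k p) :
    pairSign p R = (-1) ^ (R.1 ∩ univ.image fun i : Fin r => p (Sum.inr i)).card := by
  have hcard : (R.1 ∩ univ.image fun i : Fin r => p (Sum.inr i)).card =
      (univ.filter fun i : Fin r => p (Sum.inr i) ∈ R.1).card := by
    rw [← Finset.card_image_of_injective (univ.filter fun i : Fin r => p (Sum.inr i) ∈ R.1)
      (f := fun i => p (Sum.inr i)) fun i j h => Sum.inr_injective (p.injective h)]
    congr 1
    ext x
    simp only [mem_inter, mem_image, mem_univ, true_and, mem_filter]
    grind
  rw [hcard, ← Finset.prod_const, Finset.prod_filter, pairSign]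
  refine Finset.prod_congr rfl fun i _ => ?_
  have := (card_inter_pair_eq_one_iff p R.1 i).mp ((mem_filter.mp h).2 i)
  by_cases ha : p (Sum.inl i) ∈ R.1 <;> by_cases hb : p (Sum.inr i) ∈ R.1 <;> simp_all

theorem pairSign_of_notMem_transversals {p : PairPerm V r} {R : KSubset V k}
    (h : R ∉ transversals k p) : pairSign p R = 0 := by
  simp only [transversals, mem_filter, mem_univ, true_and, not_forall] at h
  obtain ⟨i, hi⟩ := h
  rw [card_inter_pair_eq_one_iff, not_not] at hi
  exact Finset.prod_eq_zero (mem_univ i) (by simp [hi])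

theorem pairSign_dotProduct_self (p : PairPerm V r) :
    (pairSign p : KSubset V k → ℝ) ⬝ᵥ pairSign p = (transversals k p).card := by
  rw [dotProduct, ← Finset.sum_subset (subset_univ (transversals k p))]
  · rw [Finset.sum_congr rfl fun R hR => by
      rw [pairSign_of_mem_transversals hR, ← mul_pow, neg_one_mul, neg_neg, one_pow]]
    simp
  · intro R _ hR
    rw [pairSign_of_notMem_transversals hR, zero_mul]

/-- If there is no transversal, both sides are `0` by the conventions for empty averages and
division by zero. -/
theorem signedAverage_eq (f : KSubset V k → ℝ) (p : PairPerm V r) :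
    signedAverage f p = (f ⬝ᵥ pairSign p) / ((pairSign p : KSubset V k → ℝ) ⬝ᵥ pairSign p) := by
  rw [pairSign_dotProduct_self, signedAverage, Finset.expect_eq_sum_div_card]
  congr 1
  rw [dotProduct, ← Finset.sum_subset (subset_univ (transversals k p))]
  · refine Finset.sum_congr rfl fun R hR => ?_
    rw [pairSign_of_mem_transversals hR, mul_comm]
  · intro R _ hR
    rw [pairSign_of_notMem_transversals hR, mul_zero]

/-! ### Estimates for the scalars -/

theorem card_transversals_le (p : PairPerm V r) : (transversals r p).card ≤ 2 ^ r := by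
  have : (univ : Finset (Finset (Fin r))).card = 2 ^ r := by simp
  rw [← this]
  refine Finset.card_le_card_of_injOn (fun R => univ.filter fun i => p (Sum.inl i) ∈ R.1)
    (fun _ _ => by simp) ?_
  -- A transversal of size exactly `r` has no points outside the pairs, so the `a_i` it contains
  -- determine it.
  have key : ∀ R ∈ transversals r p, R.1 = univ.image fun i =>
      if p (Sum.inl i) ∈ R.1 then p (Sum.inl i) else p (Sum.inr i) := by
    intro R hR
    symm
    apply Finset.eq_of_subset_of_card_le
    · intro x hx
      obtain ⟨i, -, rfl⟩ := Finset.mem_image.mp hx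
      have := (card_inter_pair_eq_one_iff p R.1 i).mp ((mem_filter.mp hR).2 i)
      grind
    · rw [Finset.card_image_of_injective, R.2]
      · simp
      · intro i j hij
        simp only at hij
        split_ifs at hij <;> simpa using p.injective hij
  intro R hR S hS h
  apply Subtype.ext
  have h' : ∀ i, p (Sum.inl i) ∈ R.1 ↔ p (Sum.inl i) ∈ S.1 := by
    simpa [Finset.ext_iff] using h
  rw [key R hR, key S hS]
  simp only [h']

theorem sum_inclusion_le (A : KSubset V r) :
    ∑ R : KSubset V k, inclusion A R ≤ ((Fintype.card V - r).choose (k - r) : ℝ) := by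
  simp only [inclusion, Finset.sum_boole]
  norm_cast
  have : (powersetCard (k - r) (univ \ A.1)).card = (Fintype.card V - r).choose (k - r) := by
    rw [card_powersetCard, card_sdiff_of_subset (subset_univ _), A.2, card_univ]
  rw [← this]
  refine Finset.card_le_card_of_injOn (fun R => R.1 \ A.1) (fun R hR => ?_) ?_
  · have hR : A.1 ⊆ R.1 := by simpa using hR
    simp only [mem_coe, mem_powersetCard]
    exact ⟨sdiff_subset_sdiff (subset_univ _) subset_rfl,
      by rw [card_sdiff_of_subset hR, R.2, A.2]⟩
  · intro R hR S hS h
    have hR : A.1 ⊆ R.1 := by simpa using hR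
    have hS : A.1 ⊆ S.1 := by simpa using hS
    apply Subtype.ext
    rw [← sdiff_union_of_subset hR, ← sdiff_union_of_subset hS]
    simp only at h
    rw [h]

omit [Fintype V] in
theorem abs_pairSign_le_one (p : PairPerm V r) (R : KSubset V k) : |pairSign p R| ≤ 1 := by
  rw [pairSign, Finset.abs_prod]
  refine Finset.prod_le_one (fun _ _ => abs_nonneg _) fun i _ => ?_
  split_ifs <;> norm_num

omit [Fintype V] in
theorem inclusion_nonneg (A : KSubset V m) (R : KSubset V k) : 0 ≤ inclusion A R := by
  unfold inclusion; split_ifs <;> norm_num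

omit [DecidableEq V] in
theorem pairPerm_nonempty (h : 2 * r ≤ Fintype.card V) : Nonempty (PairPerm V r) :=
  Function.Embedding.nonempty_of_card_le (by simp; omega)

theorem exists_inclusion_scalar (hr : r ≤ k) (hV : 2 * k ≤ Fintype.card V) :
    ∃ D : ℝ, 0 < D ∧
      D * (Fintype.card V).choose r ≤ (k.choose r : ℝ) * (Fintype.card V).choose k ∧
      ∀ (q : PairPerm V r) (A : KSubset V r), ∑ R : KSubset V k, inclusion A R * pairSign q R
        = D * pairSign q A := by
  obtain ⟨D, hD⟩ := (isInvariantKernel_inclusion (V := V) (m := r) (k := k)).exists_sum_mul_pairSign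
  obtain ⟨q⟩ := pairPerm_nonempty (V := V) (r := r) (by omega)
  have hq := hD q (pairLeft q)
  rw [pairSign_pairLeft, mul_one] at hq
  have hnn : ∀ R ∈ (univ : Finset (KSubset V k)), 0 ≤ inclusion (pairLeft q) R * pairSign q R := by
    intro R _
    rw [inclusion]
    split_ifs with h
    · rw [one_mul]
      refine Finset.prod_nonneg fun i _ => ?_
      have : q (Sum.inl i) ∈ R.1 := h (by simp [pairLeft])
      split_ifs <;> norm_num
    · simp
  refine ⟨D, ?_, ?_, hD⟩
  · rw [← hq]
    -- A `k`-set containing every `a_i` and no `b_i` makes the sum positive; it exists because `r ≤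
    -- k ≤ n - r`.
    obtain ⟨R, hAR, hRB, hRk⟩ := Finset.exists_subsuperset_card_eq
      (s := (pairLeft q).1) (t := univ \ univ.image fun i => q (Sum.inr i)) (n := k)
      (by
        intro x hx
        obtain ⟨i, -, rfl⟩ := Finset.mem_image.mp hx
        simp) (by rw [(pairLeft q).2]; exact hr) (by
        rw [card_sdiff_of_subset (subset_univ _), card_univ,
          Finset.card_image_of_injective _ fun i j h => Sum.inr_injective (q.injective h)]
        simp
        omega)
    refine Finset.sum_pos' hnn ⟨⟨R, hRk⟩, mem_univ _, ?_⟩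
    have h1 : ∀ i, q (Sum.inl i) ∈ R := fun i => hAR (by simp [pairLeft])
    have h2 : ∀ i, q (Sum.inr i) ∉ R := fun i hi => by simpa using hRB hi
    simp [inclusion, hAR, pairSign, h1, h2]
  · have h1 : D ≤ ((Fintype.card V - r).choose (k - r) : ℝ) := by
      rw [← hq]
      refine le_trans (Finset.sum_le_sum fun R _ => ?_) (sum_inclusion_le (pairLeft q))
      have := (abs_le.mp (abs_pairSign_le_one q R)).2
      exact mul_le_of_le_one_right (inclusion_nonneg _ _) this
    have h2 := Nat.choose_mul (n := Fintype.card V) (k := k) (s := r) hr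
    have h3 : (((Fintype.card V).choose k * k.choose r : ℕ) : ℝ) =
      ((Fintype.card V).choose r * (Fintype.card V - r).choose (k - r) : ℕ) := by rw [h2]
    push_cast at h3
    rw [mul_comm (k.choose r : ℝ), h3, mul_comm]
    gcongr

/-- The Gram kernel `∑ p, pairSign p A * pairSign p B`. -/
noncomputable def gramKernel (r : ℕ) (A : KSubset V m) (B : KSubset V k) : ℝ :=
  ∑ p : PairPerm V r, pairSign p A * pairSign p B

theorem isInvariantKernel_gramKernel :
    IsInvariantKernel (gramKernel r : KSubset V m → KSubset V k → ℝ) := by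
  intro σ A B
  unfold gramKernel
  rw [← Equiv.sum_comp (Equiv.embeddingCongr (Equiv.refl (Fin r ⊕ Fin r)) σ)]
  refine Finset.sum_congr rfl fun p _ => ?_
  have : Equiv.embeddingCongr (Equiv.refl (Fin r ⊕ Fin r)) σ p = p.trans σ.toEmbedding := by
    ext x; simp
  rw [this, pairSign_perm, pairSign_perm]

theorem pairSign_dotProduct_self_eq (p q : PairPerm V r) :
    (pairSign p : KSubset V k → ℝ) ⬝ᵥ pairSign p =
      (pairSign q : KSubset V k → ℝ) ⬝ᵥ pairSign q := by
  obtain ⟨σ, rfl⟩ := exists_perm_trans p q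
  simp only [dotProduct]
  rw [← Equiv.sum_comp (KSubset.perm k σ)
    fun R : KSubset V k => pairSign (p.trans σ.toEmbedding) R * pairSign (p.trans σ.toEmbedding) R]
  simp only [pairSign_perm]

theorem pairSign_dotProduct_self_pos (q : PairPerm V r) :
    0 < (pairSign q : KSubset V r → ℝ) ⬝ᵥ pairSign q := by
  refine Finset.sum_pos' (fun R _ => mul_self_nonneg _) ⟨pairLeft q, mem_univ _, ?_⟩
  rw [pairSign_pairLeft]
  norm_num

/-- The Gram kernel `G` is symmetric with `G² = μG`, so `G(A,A)² ≤ (G²)(A,A) = μ G(A,A)` and every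
diagonal entry is at most `μ`. Computing the trace of `G` by summing over `p` gives the lower bound
on `μ`. -/
theorem exists_gram_scalar (q : PairPerm V r) :
    ∃ μ : ℝ, Fintype.card (PairPerm V r) * ((pairSign q : KSubset V r → ℝ) ⬝ᵥ pairSign q) ≤
        μ * (Fintype.card V).choose r ∧
      ∀ (q : PairPerm V r) (A : KSubset V r),
        ∑ B : KSubset V r, gramKernel r A B * pairSign q B = μ * pairSign q A := by
  obtain ⟨μ, hμ⟩ :=
    (isInvariantKernel_gramKernel (V := V) (m := r) (k := r) (r := r)).exists_sum_mul_pairSign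
  refine ⟨μ, ?_, hμ⟩
  have hsq : ∀ A : KSubset V r, gramKernel r A A * gramKernel r A A ≤ μ * gramKernel r A A := by
    intro A
    calc gramKernel r A A * gramKernel r A A
        ≤ ∑ B : KSubset V r, gramKernel r A B * gramKernel r A B :=
          Finset.single_le_sum (f := fun B : KSubset V r => gramKernel r A B * gramKernel r A B)
            (fun B _ => mul_self_nonneg _) (mem_univ A)
      _ = ∑ p : PairPerm V r, pairSign p A * ∑ B : KSubset V r, gramKernel r A B * pairSign p B := by
          simp_rw [Finset.mul_sum]
          rw [Finset.sum_comm]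
          refine Finset.sum_congr rfl fun B _ => ?_
          nth_rw 2 [gramKernel]
          rw [Finset.mul_sum]
          exact Finset.sum_congr rfl fun p _ => by ring
      _ = μ * gramKernel r A A := by
          simp_rw [hμ]
          rw [gramKernel, Finset.mul_sum]
          exact Finset.sum_congr rfl fun p _ => by ring
  have hpos : 0 < gramKernel r (pairLeft q) (pairLeft q) := by
    refine Finset.sum_pos' (fun p _ => mul_self_nonneg _) ⟨q, mem_univ _, ?_⟩
    rw [pairSign_pairLeft]
    norm_num
  have hμ0 : 0 ≤ μ := hpos.le.trans (le_of_mul_le_mul_right (hsq _) hpos)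
  have hle : ∀ A : KSubset V r, gramKernel r A A ≤ μ := by
    intro A
    have h := hsq A
    rcases (Finset.sum_nonneg fun (p : PairPerm V r) _ => mul_self_nonneg (pairSign p A) :
      0 ≤ gramKernel r A A).eq_or_lt with h0 | h0
    · exact h0.symm.le.trans hμ0
    · exact le_of_mul_le_mul_right h h0
  calc _ = ∑ p : PairPerm V r, ((pairSign p : KSubset V r → ℝ) ⬝ᵥ pairSign p) := by
        rw [Finset.sum_congr rfl fun p _ => pairSign_dotProduct_self_eq p q]
        simp
    _ = ∑ A : KSubset V r, gramKernel r A A := by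
        simp_rw [gramKernel, dotProduct]
        rw [Finset.sum_comm]
    _ ≤ ∑ A : KSubset V r, μ := Finset.sum_le_sum fun A _ => hle A
    _ = _ := by
        rw [Finset.sum_const, nsmul_eq_mul, mul_comm, card_univ, Fintype.card_finset_len]

/-! ### Projection onto a level -/

theorem sum_gramKernel_mul (A : KSubset V m) (h : KSubset V k → ℝ) :
    ∑ B, gramKernel r A B * h B = ∑ p : PairPerm V r, (pairSign p ⬝ᵥ h) * pairSign p A := by
  simp_rw [gramKernel, dotProduct, Finset.sum_mul]
  rw [Finset.sum_comm]
  exact Finset.sum_congr rfl fun p _ => Finset.sum_congr rfl fun B _ => by ring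

theorem pairSign_dotProduct_eq_mul {D : ℝ}
    (hD : ∀ (q : PairPerm V r) (A : KSubset V r),
      ∑ R : KSubset V k, inclusion A R * pairSign q R = D * pairSign q A) (p q : PairPerm V r) :
    (pairSign p : KSubset V k → ℝ) ⬝ᵥ pairSign q =
      D * ((pairSign p : KSubset V r → ℝ) ⬝ᵥ pairSign q) := by
  simp only [dotProduct]
  rw [Finset.sum_congr rfl fun R _ => by rw [pairSign_eq_sum_inclusion p R, Finset.sum_mul],
    Finset.sum_comm, Finset.mul_sum]
  refine Finset.sum_congr rfl fun A _ => ?_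
  rw [mul_left_comm, ← hD, Finset.mul_sum]
  exact Finset.sum_congr rfl fun R _ => by ring

/-- The level-`r` sign functions form a tight frame for their span: lifting from `r`-sets to
`k`-sets contributes the factor `D`, and the Gram kernel on `r`-sets the factor `μ`. -/
theorem sum_dotProduct_mul_pairSign {D μ : ℝ}
    (hD : ∀ (q : PairPerm V r) (A : KSubset V r),
      ∑ R : KSubset V k, inclusion A R * pairSign q R = D * pairSign q A)
    (hμ : ∀ (q : PairPerm V r) (A : KSubset V r),
      ∑ B : KSubset V r, gramKernel r A B * pairSign q B = μ * pairSign q A)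
    (q : PairPerm V r) (R : KSubset V k) :
    ∑ p : PairPerm V r, ((pairSign p : KSubset V k → ℝ) ⬝ᵥ pairSign q) * pairSign p R =
      D * μ * pairSign q R := by
  rw [pairSign_eq_sum_inclusion q R, Finset.mul_sum]
  simp_rw [sum_gramKernel_mul] at hμ
  calc _ = ∑ A : KSubset V r, D * inclusion A R *
        ∑ p : PairPerm V r, ((pairSign p : KSubset V r → ℝ) ⬝ᵥ pairSign q) * pairSign p A := by
        simp_rw [Finset.mul_sum]
        rw [Finset.sum_comm]
        refine Finset.sum_congr rfl fun p _ => ?_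
        rw [pairSign_dotProduct_eq_mul hD, pairSign_eq_sum_inclusion p R, Finset.mul_sum]
        exact Finset.sum_congr rfl fun A _ => by ring
    _ = _ := by
        refine Finset.sum_congr rfl fun A _ => ?_
        rw [hμ]
        ring

theorem levelWeight_sq (f : KSubset V k → ℝ) :
    levelWeight r f ^ 2 = 𝔼 p : PairPerm V r, signedAverage f p ^ 2 :=
  Real.sq_sqrt (Finset.expect_nonneg fun _ _ => sq_nonneg _)

/-- The component of `f` in the span of the level-`r` functions `pairSign p`, with its norm
controlled by the level-`r` weight. -/
theorem exists_levelComponent (hr : r ≤ k) (hV : 2 * k ≤ Fintype.card V) (f : KSubset V k → ℝ) :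
    ∃ g : KSubset V k → ℝ, (∃ c : PairPerm V r → ℝ, g = ∑ p, c p • pairSign p) ∧
      (∀ q : PairPerm V r, g ⬝ᵥ pairSign q = f ⬝ᵥ pairSign q) ∧
      g ⬝ᵥ g ≤ 2 ^ r * k.choose r * (Fintype.card V).choose k * levelWeight r f ^ 2 := by
  obtain ⟨D, hD0, hDle, hD⟩ := exists_inclusion_scalar hr hV
  obtain ⟨q₀⟩ := pairPerm_nonempty (V := V) (r := r) (by omega)
  obtain ⟨μ, hμle, hμ⟩ := exists_gram_scalar q₀
  set t := (pairSign q₀ : KSubset V r → ℝ) ⬝ᵥ pairSign q₀ with ht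
  have ht0 : 0 < t := pairSign_dotProduct_self_pos q₀
  have ht2 : t ≤ 2 ^ r := by
    rw [ht, pairSign_dotProduct_self]
    exact_mod_cast card_transversals_le q₀
  have hN : (0 : ℝ) < Fintype.card (PairPerm V r) := by
    exact_mod_cast Fintype.card_pos_iff.mpr ⟨q₀⟩
  have hC : (0 : ℝ) < (Fintype.card V).choose r := by
    exact_mod_cast Nat.choose_pos (by omega)
  have hμ0 : 0 < μ := pos_of_mul_pos_left (lt_of_lt_of_le (mul_pos hN ht0) hμle) hC.le
  have hproj := sum_dotProduct_mul_pairSign hD hμ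
  -- Dividing by the frame constant `D * μ` turns the frame sum into the orthogonal projection.
  set g : KSubset V k → ℝ := ∑ p : PairPerm V r, ((f ⬝ᵥ pairSign p) / (D * μ)) • pairSign p with hg
  have hgq : ∀ q : PairPerm V r, g ⬝ᵥ pairSign q = f ⬝ᵥ pairSign q := by
    intro q
    calc g ⬝ᵥ pairSign q
        = ∑ p : PairPerm V r, (f ⬝ᵥ pairSign p) / (D * μ) *
            ((pairSign p : KSubset V k → ℝ) ⬝ᵥ pairSign q) := by
          rw [hg, sum_dotProduct]
          simp_rw [smul_dotProduct, smul_eq_mul]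
      _ = (D * μ)⁻¹ * ∑ R, f R * ∑ p : PairPerm V r,
            ((pairSign p : KSubset V k → ℝ) ⬝ᵥ pairSign q) * pairSign p R := by
          simp_rw [Finset.mul_sum]
          rw [Finset.sum_comm]
          refine Finset.sum_congr rfl fun p _ => ?_
          rw [dotProduct, Finset.sum_div, Finset.sum_mul]
          exact Finset.sum_congr rfl fun R _ => by ring
      _ = f ⬝ᵥ pairSign q := by
          simp_rw [hproj]
          rw [dotProduct, Finset.mul_sum]
          exact Finset.sum_congr rfl fun R _ => by field_simp
  refine ⟨g, ⟨_, hg⟩, hgq, ?_⟩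
  have hgg : g ⬝ᵥ g = (∑ p : PairPerm V r, (f ⬝ᵥ pairSign p) ^ 2) / (D * μ) := by
    nth_rw 2 [hg]
    rw [dotProduct_sum, Finset.sum_div]
    refine Finset.sum_congr rfl fun p _ => ?_
    rw [dotProduct_smul, hgq, smul_eq_mul]
    ring
  have hT : ∀ p : PairPerm V r, (pairSign p : KSubset V k → ℝ) ⬝ᵥ pairSign p = D * t := fun p => by
    rw [pairSign_dotProduct_eq_mul hD, pairSign_dotProduct_self_eq p q₀]
  have hW : levelWeight r f ^ 2 = (∑ p : PairPerm V r, (f ⬝ᵥ pairSign p) ^ 2) /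
      ((D * t) ^ 2 * Fintype.card (PairPerm V r)) := by
    rw [levelWeight_sq, Fintype.expect_eq_sum_div_card]
    simp_rw [signedAverage_eq, hT, div_pow]
    rw [← Finset.sum_div, div_div]
  have hS : 0 ≤ ∑ p : PairPerm V r, (f ⬝ᵥ pairSign p) ^ 2 :=
    Finset.sum_nonneg fun _ _ => sq_nonneg _
  have hkey : (D * t) ^ 2 * Fintype.card (PairPerm V r) ≤
      2 ^ r * k.choose r * (Fintype.card V).choose k * (D * μ) := by
    calc (D * t) ^ 2 * Fintype.card (PairPerm V r)
        = D ^ 2 * t * (Fintype.card (PairPerm V r) * t) := by ring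
      _ ≤ D ^ 2 * t * (μ * (Fintype.card V).choose r) := by gcongr
      _ = D * μ * t * (D * (Fintype.card V).choose r) := by ring
      _ ≤ D * μ * 2 ^ r * (k.choose r * (Fintype.card V).choose k) := by gcongr
      _ = _ := by ring
  rw [hgg, hW, ← mul_div_assoc, div_le_div_iff₀ (by positivity) (by positivity)]
  calc _ ≤ (∑ p : PairPerm V r, (f ⬝ᵥ pairSign p) ^ 2) *
        (2 ^ r * k.choose r * (Fintype.card V).choose k * (D * μ)) :=
        mul_le_mul_of_nonneg_left hkey hS
    _ = _ := by ring

/-! ### Removing the levels and counting exceptions -/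

theorem levelWeight_eq_zero {f : KSubset V k → ℝ}
    (h : ∀ q : PairPerm V r, f ⬝ᵥ pairSign q = 0) : levelWeight r f = 0 := by
  simp [levelWeight, signedAverage_eq, h]

theorem sum_two_pow_mul_choose_le (ℓ k : ℕ) :
    ∑ r ∈ Icc ℓ k, (2 : ℝ) ^ r * k.choose r ≤ 5 ^ k := by
  calc ∑ r ∈ Icc ℓ k, (2 : ℝ) ^ r * k.choose r ≤ ∑ r ∈ range (k + 1), (2 : ℝ) ^ r * k.choose r :=
        Finset.sum_le_sum_of_subset_of_nonneg (fun r hr => by simp at hr ⊢; omega)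
          fun _ _ _ => by positivity
    _ = (2 + 1) ^ k := by simp [add_pow]
    _ ≤ 5 ^ k := pow_le_pow_left₀ (by norm_num) (by norm_num) k

/-- Subtracting the components of all levels between `ℓ` and `k`. -/
theorem exists_levelWeight_eq_zero {ℓ : ℕ} {ε : ℝ} (hV : 2 * k ≤ Fintype.card V)
    (f : KSubset V k → ℝ) (hf : ∀ r ∈ Icc ℓ k, levelWeight r f ≤ ε) :
    ∃ h : KSubset V k → ℝ, h ⬝ᵥ h ≤ 5 ^ k * ε ^ 2 * (Fintype.card V).choose k ∧
      ∀ r ∈ Icc ℓ k, levelWeight r (f - h) = 0 := by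
  have hex : ∀ r, ∃ g : KSubset V k → ℝ, r ∈ Icc ℓ k →
      (∃ c : PairPerm V r → ℝ, g = ∑ p, c p • pairSign p) ∧
      (∀ q : PairPerm V r, g ⬝ᵥ pairSign q = f ⬝ᵥ pairSign q) ∧
      g ⬝ᵥ g ≤ 2 ^ r * k.choose r * (Fintype.card V).choose k * levelWeight r f ^ 2 := by
    intro r
    by_cases hr : r ∈ Icc ℓ k
    · obtain ⟨g, hg⟩ := exists_levelComponent (mem_Icc.mp hr).2 hV f
      exact ⟨g, fun _ => hg⟩
    · exact ⟨0, fun h => absurd h hr⟩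
  choose g hg using hex
  have horth : ∀ r ∈ Icc ℓ k, ∀ s, s ≠ r → ∀ q : PairPerm V s, g r ⬝ᵥ pairSign q = 0 := by
    intro r hr s hs q
    obtain ⟨⟨c, hc⟩, -⟩ := hg r hr
    rw [hc, sum_dotProduct]
    refine Finset.sum_eq_zero fun p _ => ?_
    rw [smul_dotProduct, pairSign_dotProduct_eq_zero hs.symm, smul_zero]
  have horth' : ∀ r ∈ Icc ℓ k, ∀ s ∈ Icc ℓ k, s ≠ r → g r ⬝ᵥ g s = 0 := by
    intro r hr s hs hsr
    obtain ⟨⟨c, hc⟩, -⟩ := hg s hs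
    rw [hc, dotProduct_sum]
    refine Finset.sum_eq_zero fun p _ => ?_
    rw [dotProduct_smul, horth r hr s hsr, smul_zero]
  refine ⟨∑ r ∈ Icc ℓ k, g r, ?_, fun r hr => levelWeight_eq_zero fun q => ?_⟩
  · calc (∑ r ∈ Icc ℓ k, g r) ⬝ᵥ (∑ r ∈ Icc ℓ k, g r) = ∑ r ∈ Icc ℓ k, g r ⬝ᵥ g r := by
          rw [sum_dotProduct]
          refine Finset.sum_congr rfl fun r hr => ?_
          rw [dotProduct_sum]
          exact Finset.sum_eq_single_of_mem r hr fun s hs hsr => horth' r hr s hs hsr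
      _ ≤ ∑ r ∈ Icc ℓ k, (2 ^ r * k.choose r) * (ε ^ 2 * (Fintype.card V).choose k : ℝ) := by
          refine Finset.sum_le_sum fun r hr => (hg r hr).2.2.trans ?_
          have : levelWeight r f ^ 2 ≤ ε ^ 2 :=
            pow_le_pow_left₀ (Real.sqrt_nonneg _) (hf r hr) 2
          calc _ ≤ (2 : ℝ) ^ r * k.choose r * (Fintype.card V).choose k * ε ^ 2 := by gcongr
            _ = _ := by ring
      _ = (∑ r ∈ Icc ℓ k, (2 : ℝ) ^ r * k.choose r) * (ε ^ 2 * (Fintype.card V).choose k) := by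
          rw [Finset.sum_mul]
      _ ≤ 5 ^ k * (ε ^ 2 * (Fintype.card V).choose k) := by
          gcongr
          exact sum_two_pow_mul_choose_le ℓ k
      _ = _ := by ring
  · rw [sub_dotProduct, sum_dotProduct,
      Finset.sum_eq_single_of_mem r hr fun s hs hsr => horth s hs r hsr.symm q,
      (hg r hr).2.1 q, sub_self]

/-- Markov's inequality for `|h|`, with its mean bounded by Cauchy–Schwarz. -/
theorem card_lt_abs_mul_le {ι : Type*} [Fintype ι] (h : ι → ℝ) (δ : ℝ) :
    ((univ.filter fun i => ¬ |h i| ≤ δ).card : ℝ) * δ ≤ √(Fintype.card ι * (h ⬝ᵥ h)) := by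
  calc ((univ.filter fun i => ¬ |h i| ≤ δ).card : ℝ) * δ
      = ∑ i ∈ univ.filter fun i => ¬ |h i| ≤ δ, δ := by rw [Finset.sum_const, nsmul_eq_mul]
    _ ≤ ∑ i ∈ univ.filter fun i => ¬ |h i| ≤ δ, |h i| :=
        Finset.sum_le_sum fun i hi => (not_le.mp (mem_filter.mp hi).2).le
    _ ≤ ∑ i, |h i| :=
        Finset.sum_le_sum_of_subset_of_nonneg (subset_univ _) fun _ _ _ => abs_nonneg _
    _ ≤ √(Fintype.card ι * (h ⬝ᵥ h)) := by
        refine Real.le_sqrt_of_sq_le ?_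
        refine (sq_sum_le_card_mul_sum_sq).trans_eq ?_
        simp [dotProduct, sq, card_univ]
end

theorem mainTheorem5 {V : Type*} [Fintype V] [DecidableEq V] (k ℓ : ℕ) (ε : ℝ)
    (hε : 0 < ε) (hℓ : 1 ≤ ℓ) (hℓk : ℓ ≤ k) (hV : 2 * k ≤ Fintype.card V)
    (f : KSubset V k → ℝ)
    (hf : (Finset.Icc ℓ k).sup' (Finset.nonempty_Icc.mpr hℓk) (fun r => levelWeight r f) ≤ ε) :
    ∃ g : KSubset V k → ℝ,
      (((Finset.univ.filter fun R : KSubset V k =>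
            ¬ |f R - g R| ≤ ε ^ (1 / 2 : ℝ)).card : ℝ) ≤
          (5 : ℝ) ^ ((k : ℝ) / 2) * ε ^ (1 / 2 : ℝ) * ((Fintype.card V).choose k : ℝ)) ∧
      ∀ r ∈ Finset.Icc ℓ k, levelWeight r g = 0 := by
  rw [Finset.sup'_le_iff] at hf
  obtain ⟨h, hh, h0⟩ := exists_levelWeight_eq_zero hV f hf
  refine ⟨f - h, ?_, h0⟩
  simp only [Pi.sub_apply, sub_sub_cancel]
  set δ : ℝ := ε ^ (1 / 2 : ℝ) with hδ
  have hδ0 : 0 < δ := Real.rpow_pos_of_pos hε _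
  have hδε : δ * δ = ε := by
    rw [hδ, ← Real.rpow_add hε]
    norm_num
  have h5 : ((5 : ℝ) ^ ((k : ℝ) / 2)) ^ 2 = 5 ^ k := by
    rw [← Real.rpow_mul_natCast (by norm_num)]
    simp
  -- After multiplication by `δ`, the target is `5^(k/2) * ε * C(n,k)`, since `δ * δ = ε`.
  refine le_of_mul_le_mul_right ((card_lt_abs_mul_le h δ).trans ?_) hδ0
  refine Real.sqrt_le_iff.mpr ⟨by positivity, ?_⟩
  rw [Fintype.card_finset_len]
  calc ((Fintype.card V).choose k : ℝ) * (h ⬝ᵥ h)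
      ≤ (Fintype.card V).choose k * (5 ^ k * ε ^ 2 * (Fintype.card V).choose k) := by gcongr
    _ = _ := by rw [← h5, ← hδε]; ring
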